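/- **Model.** A least squares regression input is a matrix $A$ with $d$ columns and a target vector $b$, all entries initially $0$, given as an infinite stream of updates; an update $(p,\Delta)$ adds $\Delta$ to one coordinate $p$ of $A$ or of $b$. Let $D\subseteq\mathbb R$ be the set of admitted values $\Delta$; assume only that $1,-1\in D$ (e.g. $D=\{1,-1\}$, $\mathbb Z$ or $\mathbb R$). Let $(A_t,b_t)$ be the input after $t$ updates. We consider three classes of streams. 1. *Turnstile updates:* $A$ has $n$ rows; any coordinate may be updated at any time and any number of times. 2. *Unique turnstile updates:* the number of rows of $A$ is unbounded, and every coordinate of $(A,b)$ is updated at most once. 3. *Turnstile updates with diverging smallest singular value:* as in 1, and $\sigma_d(A_t)\to\infty$ as $t\to\infty$. A randomized one-pass streaming algorithm keeps a bit string as its memory, rewrites it at every update as a function of the old string, the update, the time and its random choices, and after $t$ updates computes from it a solution $\tilde x_t\in\mathbb R^d$. Access to the random choices and to the time is not charged. The algorithm is *asymptotically exact* on a class of streams, with failure probability $\delta$, if for every stream of the class and every $\varepsilon>0$, $$\limsup_{t\to\infty}\ \Pr\Bigl[\ \|A_t\tilde x_t-b_t\|>(1+\varepsilon)\min_{x\in\mathbb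 R^d}\|A_tx-b_t\|\ \Bigr]\le\delta .$$ (This is implied by: with probability at least $1-\delta$ the approximation ratio tends to $1$. No bound on the memory is assumed.) **Theorem.** For every $\delta\in(0,1/2)$ there is a constant $c>0$, depending only on $\delta$, such that the following holds. 1. Let $n\ge d\ge1$. Every streaming algorithm for $n\times d$ regression that is asymptotically exact under turnstile updates uses at least $c\,nd$ bits of memory. 2. Let $d\ge2$. Every streaming algorithm for regression with $d$ columns that is asymptotically exact under unique turnstile updates uses, for every $n$, at least $c\,nd$ bits of memory on inputs with $n$ rows. 3. Let $n\ge d\ge1$. Every streaming algorithm for $n\times d$ regression that is asymptotically exact under turnstile updates whose smallest singular value diverges uses at least $c\,nd$ bits of memory. Here "uses at least $c\,nd$ bits" means that there are a stream in the respective class and a time $t\le nd$ such that, with positive probability, the memory after the first $t$ updates has length at least $c\,nd$; in 2, moreover, these $t$ updates only concern the first $n$ rows. -/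

import Mathlib

open Filter Topology MeasureTheory

/-- The coordinates of a least squares regression input `(A, b)` whose rows are indexed by `R` and
whose matrix has `d` columns: the matrix entries `A i j` and the entries `b i` of the target. -/
inductive RegCoord (R : Type) (d : ℕ) : Type
  | entry (i : R) (j : Fin d) : RegCoord R d
  | target (i : R) : RegCoord R d

/-- The row in which a coordinate lies. -/
def RegCoord.row {R : Type} {d : ℕ} : RegCoord R d → R
  | .entry i _ => i
  | .target i => i

/-- The update `(p, Δ)` adds `Δ` to coordinate `p`. -/
abbrev RegUpdate (R : Type) (d : ℕ) : Type := RegCoord R d × ℝ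

/-- An infinite stream of updates; the first update is `S 0`. -/
abbrev RegStream (R : Type) (d : ℕ) : Type := ℕ → RegUpdate R d

namespace RegStream

open Classical in
/-- Value of coordinate `p` after the first `t` updates, starting from `0`. -/
noncomputable def value {R : Type} {d : ℕ} (S : RegStream R d) (t : ℕ) (p : RegCoord R d) : ℝ :=
  ∑ s ∈ Finset.range t, if (S s).1 = p then (S s).2 else 0

/-- The matrix described by the first `t` updates. -/
noncomputable def mat {R : Type} {d : ℕ} (S : RegStream R d) (t : ℕ) : Matrix R (Fin d) ℝ :=
  fun i j => S.value t (.entry i j)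

/-- The target vector described by the first `t` updates. -/
noncomputable def rhs {R : Type} {d : ℕ} (S : RegStream R d) (t : ℕ) : R → ℝ :=
  fun i => S.value t (.target i)

/-- Turnstile streams with update values in `D`: any coordinate may be updated at any time, and
arbitrarily often. -/
def turnstile (R : Type) (d : ℕ) (D : Set ℝ) : Set (RegStream R d) :=
  {S | ∀ t, (S t).2 ∈ D}

/-- Unique turnstile streams: every coordinate is updated at most once. -/
def uniqueTurnstile (R : Type) (d : ℕ) (D : Set ℝ) : Set (RegStream R d) :=
  {S | S ∈ turnstile R d D ∧ Function.Injective fun t => (S t).1}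

/-- Turnstile streams of `n × d` inputs such that the smallest singular value `σ_d` of the matrix
tends to infinity. Mathlib's singular values are in decreasing order and numbered from `0`, so that
`σ_d` has the number `d - 1`. -/
def divergingTurnstile (n d : ℕ) (D : Set ℝ) : Set (RegStream (Fin n) d) :=
  {S | S ∈ turnstile (Fin n) d D ∧
    Tendsto (fun t => (Matrix.toEuclideanLin (S.mat t)).singularValues (d - 1)) atTop atTop}

end RegStream

/-- The least squares objective `‖A x - b‖` (Euclidean norm). The set of rows may be infinite; the
sum is only used when all but finitely many rows of `(A, b)` vanish. -/
noncomputable def lsCost {R : Type} {d : ℕ} (A : Matrix R (Fin d) ℝ) (b : R → ℝ)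
    (x : Fin d → ℝ) : ℝ :=
  √(∑ᶠ i, (A.mulVec x i - b i) ^ 2)

/-- A randomized one-pass streaming algorithm for regression. The working memory is a bit string; it
is rewritten at each update and the current solution is computed from it. The outcome `ω` contains
all the random choices. Access to `ω` and to the number `t` of updates read so far is not charged,
and the maps are arbitrary: this includes every algorithm in a concrete model of computation, where
only what is kept between two updates is counted as memory. -/
structure RegAlgorithm (Ω : Type*) (R : Type) (d : ℕ) where
  init : Ω → List Bool
  step : Ω → ℕ → List Bool → RegUpdate R d → List Bool
  output : Ω → ℕ → List Bool → (Fin d → ℝ)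

namespace RegAlgorithm

/-- Content of the memory after the first `t` updates. -/
def memory {Ω : Type*} {R : Type} {d : ℕ} (alg : RegAlgorithm Ω R d) (ω : Ω)
    (S : RegStream R d) : ℕ → List Bool
  | 0 => alg.init ω
  | t + 1 => alg.step ω t (alg.memory ω S t) (S t)

/-- The solution maintained after the first `t` updates. -/
def solution {Ω : Type*} {R : Type} {d : ℕ} (alg : RegAlgorithm Ω R d) (ω : Ω)
    (S : RegStream R d) (t : ℕ) : Fin d → ℝ :=
  alg.output ω t (alg.memory ω S t)

/-- `alg` is asymptotically exact, with failure probability `δ`, on the streams in `C`: for each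
stream in `C` and each `ε > 0`, the probability that the solution after `t` updates is not a
`(1 + ε)`-approximation of the optimum of the substream read so far has `limsup` at most `δ` as
`t → ∞`. This holds if the approximation ratio tends to `1` with probability at least `1 - δ`, and
also if, for some `ε_t → 0`, the ratio after `t` updates is at most `1 + ε_t` with probability at
least `1 - δ`. -/
def AsymptoticallyExactOn {Ω : Type*} [MeasurableSpace Ω] {R : Type} {d : ℕ}
    (alg : RegAlgorithm Ω R d) (μ : Measure Ω) (δ : ℝ) (C : Set (RegStream R d)) : Prop :=
  ∀ S ∈ C, ∀ ε > 0, ∀ δ' > δ, ∀ᶠ t in atTop,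
    μ {ω | ¬ ∀ x : Fin d → ℝ, lsCost (S.mat t) (S.rhs t) (alg.solution ω S t) ≤
      (1 + ε) * lsCost (S.mat t) (S.rhs t) x} ≤ ENNReal.ofReal δ'

/-- With positive probability, at least `m` bits of memory are in use after the first `t` updates of
the stream `S`. -/
def UsesBits {Ω : Type*} [MeasurableSpace Ω] {R : Type} {d : ℕ} (alg : RegAlgorithm Ω R d)
    (μ : Measure Ω) (S : RegStream R d) (t : ℕ) (m : ℝ) : Prop :=
  0 < μ {ω | m ≤ ((alg.memory ω S t).length : ℝ)}

end RegAlgorithm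

/-! The memory has to retain a constant fraction of N independent bits, because each of them can
still be queried. A prefix writes the bits as signs of matrix entries; a suffix that depends only on
the queried position forces every sufficiently accurate solution to reveal that bit, at arbitrarily
late times. Asymptotic exactness alone therefore yields a decoder whose error probability per bit is
eventually below a constant less than 1/2. Averaging fixes the random choices; the decoded word is
then a function of the memory after the prefix, and a decoder with such an average error takes at
least κ^N values with κ > 1 (`exists_pow_le_card_image`). Too short a memory has too few states
(`exists_usesBits_of_decode`).

Diverging singular value: to query the sign a i j, add K to the entries (r k, k), where r is
injective with r j = i, and to target i. In the unknown z = K(x - e_j), the residual in row p tends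
to a p j + z k if p = r k, and to a p j if p is outside the range of r. The limiting optimal squared
cost is n - d, at z k = -a (r k) j, while a wrong sign of z j leaves at least n - d + 1
(`mul_neg_of_scaledResidual_le`). So x j lies on the side of 1 determined by the bit. Plain
turnstile streams form a larger class.

Unique updates: entries cannot grow, but new rows can act as a ridge penalty K. With target e_i, the
vector (row i)/K is nearly optimal, and for large K a wrong sign in one coordinate costs a fixed
amount (`mul_pos_of_ridgeCost_le`). One column carries no bits and absorbs the rest of the infinite
stream. -/

/-! ### Counting on the Boolean cube and averaging over outcomes -/

/-- `∑_x q ^ dist(x, y)` over the Boolean cube, `dist` being the Hamming distance. -/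
theorem sum_pow_card_ne {ι : Type*} [Fintype ι] [DecidableEq ι] (q : ℝ) (y : ι → Bool) :
    ∑ x : ι → Bool, q ^ (Finset.univ.filter fun i => y i ≠ x i).card =
      (1 + q) ^ Fintype.card ι := by
  have h : ∀ x : ι → Bool, q ^ (Finset.univ.filter fun i => y i ≠ x i).card =
      ∏ i, if y i ≠ x i then q else 1 := by
    intro x
    rw [Finset.prod_ite]
    simp
  have h2 : ∀ i : ι, (∑ b : Bool, if y i ≠ b then q else 1) = 1 + q := by
    intro i
    cases y i <;> simp [add_comm]
  rw [Finset.sum_congr rfl fun x _ => h x,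
    ← Fintype.prod_sum (fun (i : ι) (b : Bool) => if y i ≠ b then q else 1)]
  rw [Finset.prod_congr rfl fun i _ => h2 i]
  simp

/-- A map of the Boolean cube that is wrong in an average fraction `δ < 1 / 2` of the coordinates
takes exponentially many values. -/
theorem exists_pow_le_card_image {δ : ℝ} (hδ₀ : 0 < δ) (hδ : δ < 1 / 2) :
    ∃ κ : ℝ, 1 < κ ∧ ∀ (ι : Type) [Fintype ι] [DecidableEq ι] (out : (ι → Bool) → (ι → Bool)),
      (∑ x : ι → Bool, ((Finset.univ.filter fun i => out x i ≠ x i).card : ℝ)) ≤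
        δ * (2 ^ Fintype.card ι * Fintype.card ι) →
      κ ^ Fintype.card ι ≤ ((Finset.univ.image out).card : ℝ) := by
  -- This choice of l gives 2(1 - lδ) = 2 - l + l², which exceeds the bound 2 - l + l²/2 on 1 + q;
  -- hence κ > 1.
  set l : ℝ := 1 - 2 * δ with hl
  have hl0 : 0 < l := by linarith
  set q : ℝ := Real.exp (-l) with hq
  have hq0 : 0 < q := Real.exp_pos _
  refine ⟨2 * Real.exp (-(l * δ)) / (1 + q), ?_, ?_⟩
  · rw [lt_div_iff₀ (by linarith)]
    have h1 : 1 - l * δ ≤ Real.exp (-(l * δ)) := by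
      linarith [Real.add_one_le_exp (-(l * δ))]
    have h2 : q ≤ 1 - l + l ^ 2 / 2 := by
      have h3 := Real.quadratic_le_exp_of_nonneg hl0.le
      have h4 : q * Real.exp l = 1 := by rw [hq, ← Real.exp_add]; simp
      have h5 : q * (1 + l + l ^ 2 / 2) ≤ 1 := by
        exact (mul_le_mul_of_nonneg_left h3 hq0.le).trans_eq h4
      -- The product equals 1 + l⁴/4.
      have h6 : (1 - l + l ^ 2 / 2) * (1 + l + l ^ 2 / 2) ≥ 1 := by
        nlinarith [sq_nonneg (l ^ 2)]
      have h7 : 0 < 1 + l + l ^ 2 / 2 := by positivity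
      by_contra! h
      nlinarith [mul_lt_mul_of_pos_right h h7]
    nlinarith
  · intro ι _ _ out h
    set N := Fintype.card ι with hN
    set W : (ι → Bool) → ℕ := fun x => (Finset.univ.filter fun i => out x i ≠ x i).card with hW
    have hupper : ∑ x, q ^ W x ≤ ((Finset.univ.image out).card : ℝ) * (1 + q) ^ N := by
      calc ∑ x, q ^ W x
          ≤ ∑ x : ι → Bool, ∑ y ∈ Finset.univ.image out,
              q ^ (Finset.univ.filter fun i => y i ≠ x i).card := by
            refine Finset.sum_le_sum fun x _ => ?_
            exact Finset.single_le_sum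
              (f := fun y : ι → Bool => q ^ (Finset.univ.filter fun i => y i ≠ x i).card)
              (fun y _ => by positivity)
              (Finset.mem_image_of_mem out (Finset.mem_univ x))
        _ = _ := by
            rw [Finset.sum_comm, Finset.sum_congr rfl fun y _ => sum_pow_card_ne q y]
            rw [Finset.sum_const, nsmul_eq_mul]
    have hlower : (2 * Real.exp (-(l * δ))) ^ N ≤ ∑ x, q ^ W x := by
      -- Tangent line of the exponential at error count δN. After summation over x the linear terms
      -- have a favourable sign, since the average error is at most δN.
      have hpt : ∀ x, Real.exp (-(l * δ)) ^ N * (1 - l * (W x - δ * N)) ≤ q ^ W x := by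
        intro x
        rw [hq, ← Real.exp_nat_mul, ← Real.exp_nat_mul]
        have e : (W x : ℝ) * -l = N * -(l * δ) + (-(l * (W x - δ * N))) := by ring
        rw [e, Real.exp_add]
        gcongr
        linarith [Real.add_one_le_exp (-(l * (W x - δ * N)))]
      refine le_trans ?_ (Finset.sum_le_sum fun x _ => hpt x)
      rw [← Finset.mul_sum, mul_pow, mul_comm]
      gcongr
      rw [Finset.sum_sub_distrib, ← Finset.mul_sum, Finset.sum_sub_distrib]
      simp only [Finset.sum_const, Finset.card_univ, Fintype.card_pi, Fintype.card_bool,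
        Finset.prod_const, nsmul_eq_mul, Nat.cast_pow, Nat.cast_ofNat, mul_one, ← hN]
      nlinarith [mul_le_mul_of_nonneg_left h hl0.le]
    rw [div_pow, div_le_iff₀ (by positivity)]
    exact hlower.trans hupper

/-- There are at most `4 ^ k` bit strings of length at most `k`. -/
theorem card_le_of_forall_length_le (k : ℕ) (F : Finset (List Bool))
    (hF : ∀ l ∈ F, l.length ≤ k) : F.card ≤ 4 ^ k := by
  have hsub : F ⊆ (Finset.range (k + 1)).biUnion fun j =>
      (Finset.univ : Finset (Fin j → Bool)).image List.ofFn := by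
    intro l hl
    exact Finset.mem_biUnion.2 ⟨l.length, Finset.mem_range.2 (Nat.lt_succ_of_le (hF l hl)),
      Finset.mem_image.2 ⟨l.get, Finset.mem_univ _, List.ofFn_get l⟩⟩
  have hsum : ∀ k : ℕ, ∑ j ∈ Finset.range (k + 1), 2 ^ j ≤ 4 ^ k := by
    intro k
    induction k with
    | zero => simp
    | succ k ih =>
      rw [Finset.sum_range_succ]
      have := Nat.pow_le_pow_left (show 2 ≤ 4 by norm_num) k
      rw [pow_succ 2, pow_succ 4]
      omega
  calc F.card ≤ _ := Finset.card_le_card hsub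
    _ ≤ _ := Finset.card_biUnion_le
    _ ≤ ∑ j ∈ Finset.range (k + 1), 2 ^ j := by
        refine Finset.sum_le_sum fun j _ => Finset.card_image_le.trans ?_
        simp
    _ ≤ 4 ^ k := hsum k

/-- First moment method: off any null set there is an outcome at which at most the average number of
finitely many events occurs. The events need not be measurable. -/
theorem exists_notMem_null_card_le {Ω α : Type*} [MeasurableSpace Ω] (μ : Measure Ω)
    [IsProbabilityMeasure μ] [Fintype α] (E : α → Set Ω) {δ : ℝ} (hδ : 0 ≤ δ)
    (hE : ∀ a, μ (E a) ≤ ENNReal.ofReal δ) {Z : Set Ω} (hZ : μ Z = 0) :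
    ∃ ω ∉ Z, ∀ s : Finset α, (∀ a ∈ s, ω ∈ E a) → (s.card : ℝ) ≤ δ * Fintype.card α := by
  have hm : ∀ a, MeasurableSet (toMeasurable μ (E a)) := fun a => measurableSet_toMeasurable _ _
  -- Measurable hulls have the same measure as the events, so the number of hulls containing ω is an
  -- integrand whose mean is at most δ times the number of events.
  obtain ⟨ω, hω, h⟩ := exists_notMem_null_le_lintegral (μ := μ)
    (f := fun ω => ∑ a, (toMeasurable μ (E a)).indicator (fun _ => (1 : ENNReal)) ω)
    (Finset.measurable_sum _ fun a _ => measurable_const.indicator (hm a)).aemeasurable hZ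
  refine ⟨ω, hω, fun s hs => ?_⟩
  rw [lintegral_finsetSum _ fun a _ => measurable_const.indicator (hm a)] at h
  have h1 : (s.card : ENNReal) ≤
      ∑ a, (toMeasurable μ (E a)).indicator (fun _ => (1 : ENNReal)) ω := by
    refine le_trans ?_ (Finset.sum_le_sum_of_subset (Finset.subset_univ s))
    rw [Finset.card_eq_sum_ones, Nat.cast_sum]
    refine Finset.sum_le_sum fun a ha => ?_
    rw [Set.indicator_of_mem (subset_toMeasurable μ _ (hs a ha))]
    simp
  have h2 : ∑ a, ∫⁻ ω, (toMeasurable μ (E a)).indicator (fun _ => (1 : ENNReal)) ω ∂μ ≤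
      ENNReal.ofReal (δ * Fintype.card α) := by
    calc _ ≤ ∑ _a : α, ENNReal.ofReal δ := by
          refine Finset.sum_le_sum fun a _ => ?_
          rw [lintegral_indicator_const (hm a), one_mul, measure_toMeasurable]
          exact hE a
      _ = _ := by
          rw [mul_comm, ENNReal.ofReal_mul (by positivity)]
          simp
  have h3 := h1.trans (h.trans h2)
  rw [← ENNReal.ofReal_natCast, ENNReal.ofReal_le_ofReal_iff (by positivity)] at h3
  exact h3

/-! ### From decodable bits to memory -/

namespace RegAlgorithm

theorem memory_congr {Ω : Type*} {R : Type} {d : ℕ} (alg : RegAlgorithm Ω R d) (ω : Ω)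
    {S S' : RegStream R d} {t₀ : ℕ} (h₀ : alg.memory ω S t₀ = alg.memory ω S' t₀)
    {t : ℕ} (ht : t₀ ≤ t) (h : ∀ s, t₀ ≤ s → S s = S' s) :
    alg.memory ω S t = alg.memory ω S' t := by
  induction t, ht using Nat.le_induction with
  | base => exact h₀
  | succ t ht ih => simp only [memory]; rw [ih, h t ht]

theorem memory_congr_prefix {Ω : Type*} {R : Type} {d : ℕ} (alg : RegAlgorithm Ω R d) (ω : Ω)
    {S S' : RegStream R d} {t : ℕ} (h : ∀ s < t, S s = S' s) :
    alg.memory ω S t = alg.memory ω S' t := by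
  induction t with
  | zero => rfl
  | succ t ih =>
    simp only [memory]
    rw [ih fun s hs => h s (hs.trans t.lt_succ_self), h t t.lt_succ_self]

/-- If the first `t₀` updates encode the bits `x`, and continuing with the `i`-th suffix makes every
sufficiently accurate solution reveal the bit `x i`, then some memory after `t₀` updates is large.
The constant `κ` depends only on the failure probability. -/
theorem exists_usesBits_of_decode {δ : ℝ} (hδ₀ : 0 < δ) (hδ : δ < 1 / 2) :
    ∃ κ : ℝ, 1 < κ ∧ ∀ {Ω : Type*} [MeasurableSpace Ω] (μ : Measure Ω) [IsProbabilityMeasure μ]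
      {R : Type} {d : ℕ} (alg : RegAlgorithm Ω R d) (C : Set (RegStream R d)),
      alg.AsymptoticallyExactOn μ δ C →
      ∀ {ι : Type} [Fintype ι] [Nonempty ι] (S : (ι → Bool) → ι → RegStream R d)
        (t₀ : ℕ) (τ : ℕ → ℕ) (dec : ι → (Fin d → ℝ) → Bool) (m : ℝ),
        (∀ x i, S x i ∈ C) →
        (∀ x i i', ∀ s < t₀, S x i s = S x i' s) →
        (∀ x x' i s, t₀ ≤ s → S x i s = S x' i s) →
        Tendsto τ atTop atTop →
        (∀ x i, ∃ ε > 0, ∀ᶠ k in atTop, ∀ v : Fin d → ℝ,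
          (∀ u : Fin d → ℝ, lsCost ((S x i).mat (τ k)) ((S x i).rhs (τ k)) v ≤
            (1 + ε) * lsCost ((S x i).mat (τ k)) ((S x i).rhs (τ k)) u) → dec i v = x i) →
        (4 : ℝ) ^ m ≤ κ ^ Fintype.card ι →
        ∃ x i, alg.UsesBits μ (S x i) t₀ m := by
  classical
  -- The limsup bound δ only gives probabilities eventually below any larger number; the midpoint of
  -- δ and 1/2 leaves room on both sides.
  obtain ⟨κ, hκ, H⟩ := exists_pow_le_card_image (δ := (δ + 1 / 2) / 2) (by linarith) (by linarith)
  refine ⟨κ, hκ, ?_⟩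
  intro Ω _ μ _ R d alg C hexact ι _ _ S t₀ τ dec m hC hpre hsuf hτ hdec hm
  by_contra! hno
  have hnull : ∀ x i, μ {ω | m ≤ ((alg.memory ω (S x i) t₀).length : ℝ)} = 0 := by
    intro x i
    simpa [UsesBits] using hno x i
  set δ' : ℝ := (δ + 1 / 2) / 2 with hδ'
  -- There are finitely many pairs (x, i), so one late time serves all words and all queries
  -- simultaneously.
  have hev : ∀ᶠ k in atTop, ∀ p : (ι → Bool) × ι,
      μ {ω | dec p.2 (alg.solution ω (S p.1 p.2) (τ k)) ≠ p.1 p.2} ≤ ENNReal.ofReal δ' := by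
    rw [eventually_all]
    rintro ⟨x, i⟩
    obtain ⟨ε, hε, h⟩ := hdec x i
    filter_upwards [h, hτ.eventually (hexact (S x i) (hC x i) ε hε δ' (by linarith))] with k h1 h2
    refine (measure_mono fun ω hω => ?_).trans h2
    rw [Set.mem_ofPred_eq] at hω ⊢
    exact fun hcon => hω (h1 _ hcon)
  obtain ⟨k, hk, hkt⟩ := (hev.and (hτ.eventually_ge_atTop t₀)).exists
  obtain ⟨ω, hω, hcard⟩ := exists_notMem_null_card_le μ
    (fun p : (ι → Bool) × ι => {ω | dec p.2 (alg.solution ω (S p.1 p.2) (τ k)) ≠ p.1 p.2})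
    (by linarith) hk
    (Z := ⋃ p : (ι → Bool) × ι, {ω | m ≤ ((alg.memory ω (S p.1 p.2) t₀).length : ℝ)})
    (measure_iUnion_null fun p => hnull p.1 p.2)
  simp only [Set.mem_iUnion, Set.mem_ofPred_eq, not_exists, not_le, Prod.forall] at hω
  let i₀ : ι := Classical.arbitrary ι
  let mem : (ι → Bool) → List Bool := fun x => alg.memory ω (S x i₀) t₀
  let out : (ι → Bool) → ι → Bool := fun x i => dec i (alg.solution ω (S x i) (τ k))
  have hmem : ∀ x i, alg.memory ω (S x i) t₀ = mem x := fun x i =>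
    alg.memory_congr_prefix ω (hpre x i i₀)
  -- The suffix does not depend on x, so x influences the decoded word only through the memory at
  -- time t₀.
  have hout : ∀ x x', mem x = mem x' → out x = out x' := by
    intro x x' h
    funext i
    simp only [out, solution]
    rw [alg.memory_congr ω (by rw [hmem, hmem, h]) hkt (hsuf x x' i)]
  have himage : (Finset.univ.image out).card ≤ (Finset.univ.image mem).card := by
    have : Finset.univ.image out =
        (Finset.univ.image mem).image fun l => out (Function.invFun mem l) := by
      rw [Finset.image_image]
      refine Finset.image_congr fun x _ => ?_
      exact hout _ _ (Function.invFun_eq ⟨x, rfl⟩).symm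
    rw [this]
    exact Finset.card_image_le
  have hm0 : 0 < m := lt_of_le_of_lt (Nat.cast_nonneg _) (hω (fun _ => true) i₀)
  -- Integer lengths below m are at most ⌈m⌉ - 1, which makes the count strictly smaller than 4^m
  -- even for non-integral m.
  have hk1 : 0 < ⌈m⌉₊ := Nat.ceil_pos.2 hm0
  have hlen : (Finset.univ.image mem).card ≤ 4 ^ (⌈m⌉₊ - 1) := by
    refine card_le_of_forall_length_le _ _ fun l hl => ?_
    obtain ⟨x, -, rfl⟩ := Finset.mem_image.1 hl
    have := Nat.lt_ceil.2 (hω x i₀)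
    exact Nat.le_sub_one_of_lt this
  have hlt : ((4 ^ (⌈m⌉₊ - 1) : ℕ) : ℝ) < (4 : ℝ) ^ m := by
    rw [Nat.cast_pow, ← Real.rpow_natCast, Nat.cast_ofNat]
    exact Real.rpow_lt_rpow_of_exponent_lt (by norm_num)
      (Nat.lt_ceil.1 (Nat.sub_lt hk1 Nat.one_pos))
  have hsum : (∑ x : ι → Bool, ((Finset.univ.filter fun i => out x i ≠ x i).card : ℝ)) ≤
      δ' * (2 ^ Fintype.card ι * Fintype.card ι) := by
    have h := hcard (Finset.univ.filter fun p => out p.1 p.2 ≠ p.1 p.2) fun p hp =>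
      (Finset.mem_filter.1 hp).2
    simp only [Fintype.card_prod, Fintype.card_pi, Fintype.card_bool, Finset.prod_const,
      Finset.card_univ, Nat.cast_mul, Nat.cast_pow, Nat.cast_ofNat] at h
    refine le_trans (le_of_eq ?_) h
    simp only [Finset.card_filter, Nat.cast_sum]
    rw [Fintype.sum_prod_type]
  have h1 := H ι out hsum
  have h2 : ((Finset.univ.image out).card : ℝ) ≤ ((4 ^ (⌈m⌉₊ - 1) : ℕ) : ℝ) :=
    Nat.cast_le.2 (himage.trans hlen)
  linarith

end RegAlgorithm

/-! ### Smallest singular value under large entries -/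

/-- If the rows `r k` of `A` carry a large entry in column `k` and bounded entries elsewhere, then
the smallest singular value of `A` is large. -/
theorem le_mul_singularValues {n d : ℕ} (hd : 1 ≤ d) (A : Matrix (Fin n) (Fin d) ℝ)
    (r : Fin d → Fin n) (c : ℝ) (h₁ : ∀ k, c ≤ A (r k) k)
    (h₂ : ∀ k k', k' ≠ k → |A (r k) k'| ≤ 1) :
    c - d ≤ d * (Matrix.toEuclideanLin A).singularValues (d - 1) := by
  set T := Matrix.toEuclideanLin A with hT
  set σ := T.singularValues (d - 1) with hσ
  have hσ0 : 0 ≤ σ := T.singularValues_nonneg _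
  obtain ⟨v, hv⟩ := (T.hasEigenvalue_adjoint_comp_self_sq_singularValues (n := d - 1)
    (by rw [finrank_euclideanSpace_fin]; omega)).exists_hasEigenvector
  have hnorm : ‖T v‖ = σ * ‖v‖ := by
    have h1 : ‖T v‖ ^ 2 = (σ * ‖v‖) ^ 2 := by
      rw [← real_inner_self_eq_norm_sq, ← LinearMap.adjoint_inner_left]
      have := hv.apply_eq_smul
      rw [LinearMap.comp_apply] at this
      rw [this, inner_smul_left, real_inner_self_eq_norm_sq]
      simp [mul_pow, hσ]
    exact (sq_eq_sq₀ (norm_nonneg _) (by positivity)).1 h1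
  have : Nonempty (Fin d) := ⟨⟨0, hd⟩⟩
  -- At the largest coordinate k of the singular vector, row r k alone gives ‖T v‖ ≥ (c - d)|v k|,
  -- while ‖v‖ ≤ d|v k|.
  obtain ⟨k, -, hk⟩ := Finset.exists_max_image Finset.univ (fun k => |v k|) Finset.univ_nonempty
  have hvk : 0 < |v k| := by
    refine (abs_nonneg _).lt_of_ne fun h0 => hv.2 ?_
    ext k'
    have := hk k' (Finset.mem_univ _)
    rw [← h0] at this
    simpa using abs_nonpos_iff.1 this
  have hvn : ‖v‖ ≤ d * |v k| := by
    rw [EuclideanSpace.norm_eq]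
    refine Real.sqrt_le_iff.2 ⟨by positivity, ?_⟩
    have hd' : (1 : ℝ) ≤ d := by exact_mod_cast hd
    calc ∑ i, ‖v i‖ ^ 2 ≤ ∑ _i : Fin d, |v k| ^ 2 :=
          Finset.sum_le_sum fun i hi => by
            rw [Real.norm_eq_abs]; exact pow_le_pow_left₀ (abs_nonneg _) (hk i hi) 2
      _ = d * |v k| ^ 2 := by simp
      _ ≤ (d * |v k|) ^ 2 := by
          rw [mul_pow]
          have : (d : ℝ) ≤ (d : ℝ) ^ 2 := by nlinarith
          gcongr
  have hrow : (c - d) * |v k| ≤ |T v (r k)| := by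
    have h1 : T v (r k) = A (r k) k * v k + ∑ k' ∈ Finset.univ.erase k, A (r k) k' * v k' := by
      rw [Finset.add_sum_erase _ (fun k' => A (r k) k' * v k') (Finset.mem_univ k)]
      rfl
    have h2 : |∑ k' ∈ Finset.univ.erase k, A (r k) k' * v k'| ≤ d * |v k| := by
      calc _ ≤ ∑ k' ∈ Finset.univ.erase k, |A (r k) k' * v k'| := Finset.abs_sum_le_sum_abs _ _
        _ ≤ ∑ _k' ∈ Finset.univ.erase k, |v k| := by
            refine Finset.sum_le_sum fun k' hk' => ?_
            rw [abs_mul]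
            have := h₂ k k' (Finset.ne_of_mem_erase hk')
            nlinarith [abs_nonneg (v k'), hk k' (Finset.mem_univ _)]
        _ ≤ ∑ _k' : Fin d, |v k| :=
            Finset.sum_le_sum_of_subset_of_nonneg (Finset.subset_univ _) fun _ _ _ => hvk.le
        _ = _ := by simp
    have h3 : c * |v k| ≤ |A (r k) k * v k| := by
      rw [abs_mul]
      exact mul_le_mul_of_nonneg_right ((h₁ k).trans (le_abs_self _)) hvk.le
    have h4 := abs_sub_abs_le_abs_sub (A (r k) k * v k)
      (-∑ k' ∈ Finset.univ.erase k, A (r k) k' * v k')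
    rw [sub_neg_eq_add, ← h1, abs_neg] at h4
    linarith
  have h5 : |T v (r k)| ≤ ‖T v‖ := by
    simpa using PiLp.norm_apply_le (T v) (r k)
  have h6 : (c - d) * |v k| ≤ (d * σ) * |v k| := by
    calc _ ≤ σ * ‖v‖ := hnorm ▸ hrow.trans h5
      _ ≤ σ * (d * |v k|) := by gcongr
      _ = _ := by ring
  exact le_of_mul_le_mul_right h6 hvk

/-! ### The rescaled query problem and its limit -/

/-- Residual of the rescaled unknown `z` in row `p`; see `scaledResidual_eq`. -/
noncomputable def scaledResidual {n d : ℕ} (a : Fin n → Fin d → ℝ) (r : Fin d → Fin n) (j : Fin d)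
    (h : ℝ) (z : Fin d → ℝ) (p : Fin n) : ℝ :=
  a p j + (∑ k, if r k = p then z k else 0) + h * ∑ k, a p k * z k

/-- With x = e_j + z/K the large terms K of column j and of the target cancel, leaving a problem
that converges as K → ∞. -/
theorem scaledResidual_eq {n d : ℕ} (a : Fin n → Fin d → ℝ) (r : Fin d → Fin n) (j : Fin d)
    {K : ℝ} (hK : K ≠ 0) (x : Fin d → ℝ) (p : Fin n) :
    scaledResidual a r j K⁻¹ (fun k => K * (x k - if k = j then 1 else 0)) p =
      (∑ k, (a p k + if r k = p then K else 0) * x k) - if r j = p then K else 0 := by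
  have h1 : (∑ k, a p k * (K * (x k - if k = j then 1 else 0))) =
      K * ((∑ k, a p k * x k) - a p j) := by
    simp only [mul_sub, mul_ite, mul_one, mul_zero, Finset.sum_sub_distrib, Finset.sum_ite_eq',
      Finset.mem_univ, if_true]
    rw [Finset.mul_sum, mul_comm (a p j)]
    congr 1
    exact Finset.sum_congr rfl fun k _ => by ring
  have h2 : (∑ k, if r k = p then K * (x k - if k = j then 1 else 0) else 0) =
      (∑ k, (if r k = p then K else 0) * x k) - if r j = p then K else 0 := by
    have : ∀ k, (if r k = p then K * (x k - if k = j then 1 else 0) else 0) =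
        (if r k = p then K else 0) * x k - if k = j then (if r k = p then K else 0) else 0 := by
      intro k; split_ifs <;> ring
    simp only [this, Finset.sum_sub_distrib, Finset.sum_ite_eq', Finset.mem_univ, if_true]
  rw [scaledResidual, h1, h2, inv_mul_cancel_left₀ hK]
  simp only [add_mul, Finset.sum_add_distrib]
  ring

theorem one_sub_two_mul_le_add_sq {y w e : ℝ} (hy : 1 ≤ |y|) (h₁ : -e ≤ w) (h₂ : w ≤ e) :
    1 - 2 * e ≤ (y + w) ^ 2 := by
  rcases le_abs.1 hy with h | h
  · nlinarith [sq_nonneg (y + w - 1)]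
  · nlinarith [sq_nonneg (y + w + 1)]

set_option maxHeartbeats 1000000 in
/-- A near-optimal `z` for the scaled problem has the sign of `-a (r j) j` in coordinate `j`. -/
theorem mul_neg_of_scaledResidual_le {n d : ℕ} (hd : 1 ≤ d) (hdn : d ≤ n) (a : Fin n → Fin d → ℝ)
    (ha : ∀ p k, a p k = 1 ∨ a p k = -1) (r : Fin d → Fin n) (hr : Function.Injective r)
    (j : Fin d) :
    ∃ ε > (0 : ℝ), ∃ B : ℝ, ∀ h : ℝ, 0 ≤ h → h * B ≤ 1 → ∀ z : Fin d → ℝ,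
      ∑ p, scaledResidual a r j h z p ^ 2 ≤
        (1 + ε) ^ 2 * ∑ p, scaledResidual a r j h (fun k => -a (r k) j) p ^ 2 →
      a (r j) j * z j < 0 := by
  classical
  have habs : ∀ p k, |a p k| = 1 := fun p k => by rcases ha p k with h | h <;> simp [h]
  have hd' : (1 : ℝ) ≤ d := by exact_mod_cast hd
  have hdn' : (d : ℝ) ≤ n := by exact_mod_cast hdn
  have hn0 : (0 : ℝ) < n := by linarith
  set s₁ : ℝ := 2 * d * (16 * n + 2) with hs₁
  have hs₁0 : 0 ≤ s₁ := by positivity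
  -- Since (1 + ε)² ≤ 1 + 3ε, this ε loses at most 1/2 of the gap 1. The first summand of B keeps
  -- the errors of order h below 1/4 in total; the second gives hd ≤ 1/2, used to bound z.
  refine ⟨1 / (6 * n), by positivity, 4 * (2 * s₁ * (n + 1) + 12 * d * n) + 2 * d, ?_⟩
  set ε : ℝ := 1 / (6 * n) with hε
  intro h h0 hB z hz
  have hεn : ε * n = 1 / 6 := by rw [hε]; field_simp
  have hε0 : 0 < ε := by positivity
  have hε1 : ε ≤ 1 / 6 := by nlinarith
  have hhd : h * (2 * d) ≤ 1 := by
    have : 0 ≤ h * (4 * (2 * s₁ * (n + 1) + 12 * d * n)) := by positivity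
    linarith
  have hsum_r : ∀ (w : Fin d → ℝ) (k : Fin d), (∑ k', if r k' = r k then w k' else 0) = w k := by
    intro w k; simp [hr.eq_iff]
  have hsum_nr : ∀ (w : Fin d → ℝ) (p : Fin n), p ∉ Finset.univ.image r →
      (∑ k', if r k' = p then w k' else 0) = 0 := by
    intro w p hp
    refine Finset.sum_eq_zero fun k' _ => if_neg fun hk => hp ?_
    exact Finset.mem_image.2 ⟨k', Finset.mem_univ _, hk⟩
  have hdot : ∀ (w : Fin d → ℝ) p, |h * ∑ k, a p k * w k| ≤ h * ∑ k, |w k| := by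
    intro w p
    rw [abs_mul, abs_of_nonneg h0]
    refine mul_le_mul_of_nonneg_left ((Finset.abs_sum_le_sum_abs _ _).trans ?_) h0
    exact Finset.sum_le_sum fun k _ => by rw [abs_mul, habs, one_mul]
  -- Indicator of the n - d rows outside the range of r, whose residual ±1 cannot be cancelled in
  -- the limit.
  set c : Fin n → ℝ := fun p => if p ∈ Finset.univ.image r then 0 else 1 with hc
  have hcsum : ∑ p, c p = n - d := by
    have h1 : ∀ p, c p = 1 - if p ∈ Finset.univ.image r then 1 else 0 := by
      intro p; simp only [hc]; split_ifs <;> norm_num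
    rw [Finset.sum_congr rfl fun p _ => h1 p, Finset.sum_sub_distrib, Finset.sum_ite_mem]
    simp [Finset.card_image_of_injective _ hr]
  have hupper : ∑ p, scaledResidual a r j h (fun k => -a (r k) j) p ^ 2 ≤
      (n - d) + 3 * h * d * n := by
    have hpt : ∀ p, scaledResidual a r j h (fun k => -a (r k) j) p ^ 2 ≤ c p + 3 * h * d := by
      intro p
      have h1 := hdot (fun k => -a (r k) j) p
      simp only [abs_neg, habs, Finset.sum_const, Finset.card_univ, Fintype.card_fin, nsmul_eq_mul,
        mul_one] at h1
      rw [abs_le] at h1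
      simp only [scaledResidual]
      set y := h * ∑ k, a p k * -a (r k) j
      have hhd0 : 0 ≤ h * d := by positivity
      by_cases hp : p ∈ Finset.univ.image r
      · obtain ⟨k, -, rfl⟩ := Finset.mem_image.1 hp
        rw [hsum_r (fun k => -a (r k) j)]
        simp only [hc, if_pos hp]
        nlinarith
      · rw [hsum_nr _ _ hp]
        simp only [hc, if_neg hp]
        rcases ha p j with h2 | h2 <;> rw [h2] <;> nlinarith
    refine (Finset.sum_le_sum fun p _ => hpt p).trans_eq ?_
    rw [Finset.sum_add_distrib, hcsum]
    simp only [Finset.sum_const, Finset.card_univ, Fintype.card_fin, nsmul_eq_mul]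
    ring
  have htot : ∑ p, scaledResidual a r j h z p ^ 2 ≤ (1 + 3 * ε) * ((n - d) + 3 * h * d * n) := by
    refine hz.trans (mul_le_mul (by nlinarith) hupper
      (Finset.sum_nonneg fun p _ => sq_nonneg _) (by positivity))
  have h3hd : 3 * h * d * n ≤ 2 * n := by nlinarith
  set s := ∑ k, |z k| with hs
  -- Bounded residuals bound each |z k| up to the perturbation hs; summing over k gives s ≤ d(16n +
  -- 2) + hds, and hd ≤ 1/2 absorbs the last term.
  have hsbound : s ≤ s₁ := by
    have hR : ∀ p, |scaledResidual a r j h z p| ≤ 16 * n + 1 := by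
      intro p
      have h1 : scaledResidual a r j h z p ^ 2 ≤ _ :=
        (Finset.single_le_sum (f := fun p => scaledResidual a r j h z p ^ 2)
          (fun p _ => sq_nonneg _) (Finset.mem_univ p)).trans htot
      have h2 : (1 + 3 * ε) * ((n - d) + 3 * h * d * n) ≤ 2 * (3 * n) := by
        have : (0 : ℝ) ≤ n - d := by linarith
        gcongr <;> linarith
      rw [← sq_abs] at h1
      nlinarith [sq_nonneg (|scaledResidual a r j h z p| - 1)]
    have hzk : ∀ k, |z k| ≤ (16 * n + 2) + h * s := by
      intro k
      have h1 : z k = scaledResidual a r j h z (r k) - a (r k) j - h * ∑ k', a (r k) k' * z k' := by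
        rw [scaledResidual, hsum_r]; ring
      rw [h1]
      have h2 := abs_sub (scaledResidual a r j h z (r k) - a (r k) j) (h * ∑ k', a (r k) k' * z k')
      have h3 := abs_sub (scaledResidual a r j h z (r k)) (a (r k) j)
      have h4 := hdot z (r k)
      have h5 := hR (r k)
      rw [habs] at h3
      linarith
    have h1 : s ≤ d * ((16 * n + 2) + h * s) := by
      refine (Finset.sum_le_sum fun k _ => hzk k).trans_eq ?_
      rw [Finset.sum_const, Finset.card_univ, Fintype.card_fin, nsmul_eq_mul]
    have hs0 : 0 ≤ s := Finset.sum_nonneg fun k _ => abs_nonneg _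
    nlinarith
  by_contra! hwrong
  -- If z j does not oppose a (r j) j, row r j also keeps a residual of size at least 1 before
  -- perturbation.
  have hlower : ((n : ℝ) - d + 1) * (1 - 2 * (h * s)) ≤ ∑ p, scaledResidual a r j h z p ^ 2 := by
    have hpt : ∀ p, (c p + if p = r j then 1 else 0) * (1 - 2 * (h * s)) ≤
        scaledResidual a r j h z p ^ 2 := by
      intro p
      have h1 := abs_le.1 (hdot z p)
      by_cases hp : p ∈ Finset.univ.image r
      · by_cases hpj : p = r j
        · subst hpj
          simp only [hc, if_pos hp, if_true, zero_add, one_mul]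
          rw [scaledResidual, hsum_r]
          refine one_sub_two_mul_le_add_sq ?_ h1.1 h1.2
          rcases ha (r j) j with h2 | h2 <;> rw [h2] at hwrong ⊢
          · exact le_abs.2 (Or.inl (by linarith))
          · exact le_abs.2 (Or.inr (by linarith))
        · simp only [hc, if_pos hp, if_neg hpj, zero_add, zero_mul]
          exact sq_nonneg _
      · have hpj : p ≠ r j := fun e => hp (e ▸ Finset.mem_image_of_mem _ (Finset.mem_univ _))
        simp only [hc, if_neg hp, if_neg hpj, add_zero, one_mul]
        rw [scaledResidual, hsum_nr _ _ hp, add_zero]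
        exact one_sub_two_mul_le_add_sq (habs p j).ge h1.1 h1.2
    refine le_trans (le_of_eq ?_) (Finset.sum_le_sum fun p _ => hpt p)
    rw [← Finset.sum_mul, Finset.sum_add_distrib, hcsum]
    simp
  have h1 := hlower.trans htot
  have h2 : h * s ≤ h * s₁ := mul_le_mul_of_nonneg_left hsbound h0
  have h3 : ε * (n - d) ≤ 1 / 6 := by nlinarith
  have h4 : ((n : ℝ) - d + 1) * (h * s) ≤ (n + 1) * (h * s₁) :=
    mul_le_mul (by linarith) h2 (by positivity) (by positivity)
  have h5 : ε * (3 * h * d * n) ≤ 1 * (3 * h * d * n) := by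
    gcongr; linarith
  have h6 : 0 ≤ 3 * h * d * n := by positivity
  have h7 : h * (4 * (2 * s₁ * (n + 1) + 12 * d * n) + 2 * d) =
    8 * ((n + 1) * (h * s₁)) + 16 * (3 * h * d * n) + h * (2 * d) := by ring
  have h8 : 0 ≤ h * (2 * d) := by positivity
  linarith

/-! ### Values along concatenated and periodic streams; writing bits -/

namespace RegStream

open Classical in
theorem value_add {R : Type} {d : ℕ} (S : RegStream R d) (t₀ s : ℕ) (p : RegCoord R d) :
    S.value (t₀ + s) p = S.value t₀ p + RegStream.value (fun k => S (t₀ + k)) s p :=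
  Finset.sum_range_add _ _ _

theorem value_mono {R : Type} {d : ℕ} (S : RegStream R d) (hS : ∀ s, 0 ≤ (S s).2)
    (p : RegCoord R d) : Monotone fun t => S.value t p := by
  intro s t hst
  refine Finset.sum_le_sum_of_subset_of_nonneg (Finset.range_mono hst) fun u _ _ => ?_
  split_ifs
  exacts [hS u, le_rfl]

theorem value_eq_zero {R : Type} {d : ℕ} (S : RegStream R d) (p : RegCoord R d) (t : ℕ)
    (hS : ∀ s < t, (S s).1 ≠ p) : S.value t p = 0 :=
  Finset.sum_eq_zero fun s hs => if_neg (hS s (Finset.mem_range.1 hs))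

/-- The stream which repeats `N + 1` given updates forever. -/
def periodic {R : Type} {d N : ℕ} (U : Fin (N + 1) → RegUpdate R d) : RegStream R d :=
  fun s => U (Fin.ofNat (N + 1) s)

open Classical in
theorem value_periodic {R : Type} {d N : ℕ} (U : Fin (N + 1) → RegUpdate R d) (K : ℕ)
    (p : RegCoord R d) :
    (periodic U).value (K * (N + 1)) p = K * ∑ u, if (U u).1 = p then (U u).2 else 0 := by
  induction K with
  | zero => simp [value]
  | succ K ih =>
    rw [Nat.succ_mul, value_add, ih, Nat.cast_succ, add_one_mul]
    congr 1
    have h : ∀ k, periodic U (K * (N + 1) + k) = U (Fin.ofNat (N + 1) k) := by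
      intro k
      refine congrArg U (Fin.ext ?_)
      simp [Fin.ofNat]
    simp only [value, h]
    rw [← Fin.sum_univ_eq_sum_range
      (fun k => if (U (Fin.ofNat (N + 1) k)).1 = p then (U (Fin.ofNat (N + 1) k)).2 else 0)]
    simp

/-- The finite list of updates `P` followed by the stream `Q`. -/
def append {R : Type} {d t₀ : ℕ} (P : Fin t₀ → RegUpdate R d) (Q : RegStream R d) :
    RegStream R d :=
  fun s => if h : s < t₀ then P ⟨s, h⟩ else Q (s - t₀)

theorem append_of_lt {R : Type} {d t₀ : ℕ} (P : Fin t₀ → RegUpdate R d) (Q : RegStream R d)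
    {s : ℕ} (h : s < t₀) : append P Q s = P ⟨s, h⟩ := dif_pos h

theorem append_add {R : Type} {d t₀ : ℕ} (P : Fin t₀ → RegUpdate R d) (Q : RegStream R d)
    (s : ℕ) : append P Q (t₀ + s) = Q s := by
  simp [append]

open Classical in
theorem value_append {R : Type} {d t₀ : ℕ} (P : Fin t₀ → RegUpdate R d) (Q : RegStream R d)
    (s : ℕ) (p : RegCoord R d) :
    (append P Q).value (t₀ + s) p =
      (∑ k, if (P k).1 = p then (P k).2 else 0) + Q.value s p := by
  rw [value_add]
  congr 1
  · rw [value, ← Fin.sum_univ_eq_sum_range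
      (fun k => if (append P Q k).1 = p then (append P Q k).2 else 0)]
    exact Finset.sum_congr rfl fun k _ => by rw [append_of_lt P Q k.2]
  · simp only [append_add]

end RegStream

/-- The sign encoding a bit. -/
def bitSign (b : Bool) : ℝ := if b then 1 else -1

theorem bitSign_eq_or (b : Bool) : bitSign b = 1 ∨ bitSign b = -1 := by
  cases b <;> simp [bitSign]

theorem abs_bitSign (b : Bool) : |bitSign b| = 1 := by
  cases b <;> simp [bitSign]

theorem bitSign_mem {D : Set ℝ} (h₁ : 1 ∈ D) (h₂ : -1 ∈ D) (b : Bool) : bitSign b ∈ D := by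
  cases b
  exacts [h₂, h₁]

/-- The updates which write the bits `x`, as signs, to the coordinates given by `f`. -/
noncomputable def encodeBits {R : Type} {d n e : ℕ} (f : Fin n × Fin e → RegCoord R d)
    (x : Fin n × Fin e → Bool) : Fin (n * e) → RegUpdate R d :=
  fun k => (f (finProdFinEquiv.symm k), bitSign (x (finProdFinEquiv.symm k)))

open Classical in
theorem sum_encodeBits {R : Type} {d n e : ℕ} (f : Fin n × Fin e → RegCoord R d)
    (x : Fin n × Fin e → Bool) (p : RegCoord R d) :
    (∑ k, if (encodeBits f x k).1 = p then (encodeBits f x k).2 else 0) =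
      ∑ q, if f q = p then bitSign (x q) else 0 :=
  Equiv.sum_comp finProdFinEquiv.symm fun q => if f q = p then bitSign (x q) else 0

/-! ### The hard streams with diverging smallest singular value -/

section Diverging

variable {n d : ℕ}

/-- An injective assignment of rows to columns which assigns row `i` to column `j`. -/
def rowOfCol (h : d ≤ n) (i : Fin n) (j : Fin d) : Fin d → Fin n :=
  fun k => Equiv.swap (Fin.castLE h j) i (Fin.castLE h k)

theorem rowOfCol_self (h : d ≤ n) (i : Fin n) (j : Fin d) : rowOfCol h i j j = i := by
  simp [rowOfCol]

theorem rowOfCol_injective (h : d ≤ n) (i : Fin n) (j : Fin d) :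
    Function.Injective (rowOfCol h i j) :=
  (Equiv.injective _).comp (Fin.castLE_injective h)

/-- The updates repeated by the query of the entry in row `r j` and column `j`. -/
noncomputable def queryUpdates (r : Fin d → Fin n) (j : Fin d) :
    Fin (d + 1) → RegUpdate (Fin n) d :=
  Fin.snoc (α := fun _ => RegUpdate (Fin n) d) (fun k => (RegCoord.entry (r k) k, 1))
    (RegCoord.target (r j), 1)

theorem queryUpdates_snd (r : Fin d → Fin n) (j : Fin d) (u : Fin (d + 1)) :
    (queryUpdates r j u).2 = 1 := by
  induction u using Fin.lastCases with
  | last => simp [queryUpdates]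
  | cast k => simp [queryUpdates]

theorem queryUpdates_ne (r : Fin d → Fin n) (j : Fin d) {p : Fin n} {k : Fin d} (h : r k ≠ p)
    (u : Fin (d + 1)) : (queryUpdates r j u).1 ≠ .entry p k := by
  induction u using Fin.lastCases with
  | last => simp [queryUpdates]
  | cast k' =>
    simp only [queryUpdates, Fin.snoc_castSucc, ne_eq, RegCoord.entry.injEq, not_and]
    rintro h1 rfl
    exact h h1

open Classical in
theorem sum_queryUpdates_entry (r : Fin d → Fin n) (j : Fin d) (p : Fin n) (k : Fin d) :
    (∑ u, if (queryUpdates r j u).1 = .entry p k then (queryUpdates r j u).2 else 0) =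
      if r k = p then (1 : ℝ) else 0 := by
  rw [Fin.sum_univ_castSucc]
  simp only [queryUpdates, Fin.snoc_castSucc, Fin.snoc_last, RegCoord.entry.injEq, reduceCtorEq,
    if_false, add_zero]
  rw [Finset.sum_eq_single k]
  · simp
  · intro k' _ hk'
    simp [hk']
  · simp

open Classical in
theorem sum_queryUpdates_target (r : Fin d → Fin n) (j : Fin d) (p : Fin n) :
    (∑ u, if (queryUpdates r j u).1 = .target p then (queryUpdates r j u).2 else 0) =
      if r j = p then (1 : ℝ) else 0 := by
  rw [Fin.sum_univ_castSucc]
  simp [queryUpdates]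

/-- All entries of the matrix are signs encoding bits; then large multiples of the identity are
added, in the rows `rowOfCol h i j`, together with a multiple of the `i`-th unit target. -/
noncomputable def divergingStream (h : d ≤ n) (x : Fin n × Fin d → Bool) (q : Fin n × Fin d) :
    RegStream (Fin n) d :=
  RegStream.append (encodeBits (fun q => .entry q.1 q.2) x)
    (RegStream.periodic (queryUpdates (rowOfCol h q.1 q.2) q.2))

theorem divergingStream_value_entry (h : d ≤ n) (x : Fin n × Fin d → Bool) (q : Fin n × Fin d)
    (s : ℕ) (p : Fin n) (k : Fin d) :
    (divergingStream h x q).value (n * d + s) (.entry p k) = bitSign (x (p, k)) +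
      (RegStream.periodic (queryUpdates (rowOfCol h q.1 q.2) q.2)).value s (.entry p k) := by
  classical
  rw [divergingStream, RegStream.value_append, sum_encodeBits, Finset.sum_eq_single (p, k)]
  · simp
  · rintro ⟨p', k'⟩ _ hne
    exact if_neg fun e => hne (by simpa using e)
  · simp

theorem divergingStream_value_target (h : d ≤ n) (x : Fin n × Fin d → Bool) (q : Fin n × Fin d)
    (s : ℕ) (p : Fin n) :
    (divergingStream h x q).value (n * d + s) (.target p) =
      (RegStream.periodic (queryUpdates (rowOfCol h q.1 q.2) q.2)).value s (.target p) := by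
  classical
  rw [divergingStream, RegStream.value_append, sum_encodeBits]
  simp

/-- After s / (d + 1) complete rounds the entries (r k, k) are at least that number minus 1. A
partial round only increases them, and injectivity of r keeps the other entries of these rows at ±1.
-/
theorem divergingStream_mem (h : d ≤ n) (hd : 1 ≤ d) {D : Set ℝ} (h1 : 1 ∈ D) (h2 : -1 ∈ D)
    (x : Fin n × Fin d → Bool) (q : Fin n × Fin d) :
    divergingStream h x q ∈ RegStream.divergingTurnstile n d D := by
  set r := rowOfCol h q.1 q.2 with hr
  constructor
  · intro t
    rcases lt_or_ge t (n * d) with ht | ht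
    · rw [divergingStream, RegStream.append_of_lt _ _ ht]
      exact bitSign_mem h1 h2 _
    · obtain ⟨s, rfl⟩ := Nat.exists_eq_add_of_le ht
      rw [divergingStream, RegStream.append_add, RegStream.periodic, queryUpdates_snd]
      exact h1
  · rw [← tendsto_add_atTop_iff_nat (n * d)]
    have hlow : ∀ s : ℕ, (((s / (d + 1) : ℕ) : ℝ) - 1 - d) / d ≤ (Matrix.toEuclideanLin
        ((divergingStream h x q).mat (s + n * d))).singularValues (d - 1) := by
      intro s
      rw [div_le_iff₀ (by exact_mod_cast hd), mul_comm]
      refine le_mul_singularValues hd _ r _ (fun k => ?_) fun k k' hk => ?_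
      · have hv := RegStream.value_mono (RegStream.periodic (queryUpdates r q.2))
          (fun s => by rw [RegStream.periodic, queryUpdates_snd]; norm_num) (.entry (r k) k)
          (Nat.div_mul_le_self s (d + 1))
        dsimp only at hv
        rw [RegStream.value_periodic, sum_queryUpdates_entry, if_pos rfl, mul_one] at hv
        rw [RegStream.mat, add_comm s, divergingStream_value_entry]
        have := (abs_le.1 (abs_bitSign (x (r k, k))).le).1
        linarith
      · rw [RegStream.mat, add_comm s, divergingStream_value_entry, RegStream.value_eq_zero,
          add_zero, abs_bitSign]
        intro s _
        exact queryUpdates_ne r q.2 (fun e => hk (rowOfCol_injective h _ _ e)) _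
    refine tendsto_atTop_mono hlow ?_
    refine Tendsto.atTop_div_const (by exact_mod_cast hd) ?_
    have h3 : Tendsto (fun s : ℕ => ((s / (d + 1) : ℕ) : ℝ)) atTop atTop :=
      tendsto_natCast_atTop_atTop.comp (Nat.tendsto_div_const_atTop d.succ_ne_zero)
    simpa only [sub_eq_add_neg, add_assoc] using tendsto_atTop_add_const_right atTop _ h3

theorem divergingStream_cost (h : d ≤ n) (x : Fin n × Fin d → Bool) (q : Fin n × Fin d) {K : ℕ}
    (hK : K ≠ 0) (v : Fin d → ℝ) :
    lsCost ((divergingStream h x q).mat (n * d + K * (d + 1)))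
        ((divergingStream h x q).rhs (n * d + K * (d + 1))) v =
      √(∑ p, scaledResidual (fun p k => bitSign (x (p, k))) (rowOfCol h q.1 q.2) q.2 (K : ℝ)⁻¹
        (fun k => K * (v k - if k = q.2 then 1 else 0)) p ^ 2) := by
  classical
  rw [lsCost, finsum_eq_sum_of_fintype]
  congr 1
  refine Finset.sum_congr rfl fun p _ => ?_
  rw [scaledResidual_eq _ _ _ (by exact_mod_cast hK)]
  congr 2
  · simp only [Matrix.mulVec, dotProduct, RegStream.mat]
    refine Finset.sum_congr rfl fun k _ => ?_
    rw [divergingStream_value_entry, RegStream.value_periodic, sum_queryUpdates_entry]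
    simp
  · rw [RegStream.rhs, divergingStream_value_target, RegStream.value_periodic,
      sum_queryUpdates_target]
    simp

/-- Comparison with the limiting minimizer z₀, that is with e_j + z₀/K, determines the sign of z j =
K(v j - 1). It is opposite to the encoded sign, hence the threshold 1. Only times after complete
rounds are used. -/
theorem divergingStream_decode (h : d ≤ n) (hd : 1 ≤ d) (x : Fin n × Fin d → Bool)
    (q : Fin n × Fin d) :
    ∃ ε > (0 : ℝ), ∀ᶠ K : ℕ in atTop, ∀ v : Fin d → ℝ,
      (∀ u : Fin d → ℝ, lsCost ((divergingStream h x q).mat (n * d + K * (d + 1)))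
          ((divergingStream h x q).rhs (n * d + K * (d + 1))) v ≤
        (1 + ε) * lsCost ((divergingStream h x q).mat (n * d + K * (d + 1)))
          ((divergingStream h x q).rhs (n * d + K * (d + 1))) u) →
      decide (v q.2 < 1) = x q := by
  obtain ⟨ε, hε, B, H⟩ := mul_neg_of_scaledResidual_le hd h (fun p k => bitSign (x (p, k)))
    (fun p k => bitSign_eq_or _) (rowOfCol h q.1 q.2) (rowOfCol_injective h _ _) q.2
  refine ⟨ε, hε, ?_⟩
  filter_upwards [eventually_ge_atTop 1, tendsto_natCast_atTop_atTop.eventually_ge_atTop B]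
    with K hK1 hKB v hv
  have hK0 : (0 : ℝ) < K := by exact_mod_cast hK1
  set z₀ : Fin d → ℝ := fun k => -bitSign (x (rowOfCol h q.1 q.2 k, q.2)) with hz₀
  have hu := hv fun k => (if k = q.2 then 1 else 0) + (K : ℝ)⁻¹ * z₀ k
  rw [divergingStream_cost h x q (by omega), divergingStream_cost h x q (by omega)] at hu
  have hz : (fun k => (K : ℝ) * ((if k = q.2 then 1 else 0) + (K : ℝ)⁻¹ * z₀ k -
      if k = q.2 then 1 else 0)) = z₀ := by
    funext k
    rw [add_sub_cancel_left, mul_inv_cancel_left₀ hK0.ne']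
  rw [hz] at hu
  have hsq := pow_le_pow_left₀ (Real.sqrt_nonneg _) hu 2
  rw [mul_pow, Real.sq_sqrt (Finset.sum_nonneg fun p _ => sq_nonneg _),
    Real.sq_sqrt (Finset.sum_nonneg fun p _ => sq_nonneg _)] at hsq
  have hneg := H (K : ℝ)⁻¹ (by positivity)
    (by rw [inv_mul_le_iff₀ hK0, mul_one]; exact hKB) _ hsq
  simp only [rowOfCol_self, if_true] at hneg
  cases hb : x q
  · have hb' : bitSign (x (q.1, q.2)) = -1 := by rw [Prod.mk.eta, hb]; rfl
    rw [hb'] at hneg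
    have : 0 < K * (v q.2 - 1) := by linarith
    have := pos_of_mul_pos_right this hK0.le
    simp only [decide_eq_false_iff_not, not_lt]
    linarith
  · have hb' : bitSign (x (q.1, q.2)) = 1 := by rw [Prod.mk.eta, hb]; rfl
    rw [hb', one_mul] at hneg
    have := neg_of_mul_neg_right hneg hK0.le
    simp only [decide_eq_true_eq]
    linarith

end Diverging

/-! ### The hard streams with unique updates: ridge regression -/

section Unique

variable {n m : ℕ}

/-- The ridge regression objective: signs `a`, target the `i`-th unit vector, regularization `K` on
all columns but the last one, and `L` on the last one. -/
noncomputable def ridgeCost (a : Fin n → Fin (m + 1) → ℝ) (i : Fin n) (K L : ℝ)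
    (v : Fin (m + 2) → ℝ) : ℝ :=
  ∑ p, ((∑ k, a p k * v k.castSucc) - if i = p then 1 else 0) ^ 2 +
    (K * ∑ k : Fin (m + 1), v k.castSucc ^ 2 + L * v (Fin.last (m + 1)) ^ 2)

theorem ridgeCost_nonneg (a : Fin n → Fin (m + 1) → ℝ) (i : Fin n) {K L : ℝ} (hK : 0 ≤ K)
    (hL : 0 ≤ L) (v : Fin (m + 2) → ℝ) : 0 ≤ ridgeCost a i K L v := by
  unfold ridgeCost
  positivity

/-- Row i and the penalty contribute 1 - 2(m+1)/K + (m+1)/K up to a square; all n squared inner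
products are at most ((m+1)/K)². -/
theorem ridgeCost_candidate_le (a : Fin n → Fin (m + 1) → ℝ) (ha : ∀ p k, a p k = 1 ∨ a p k = -1)
    (i : Fin n) {K : ℝ} (hK : 0 < K) (L : ℝ) :
    ridgeCost a i K L (Fin.snoc (α := fun _ => ℝ) (fun k => a i k / K) 0) ≤
      1 - (m + 1) / K + n * (m + 1) ^ 2 / K ^ 2 := by
  have hsq : ∀ p k, a p k ^ 2 = 1 := fun p k => by rcases ha p k with h | h <;> simp [h]
  have habs : ∀ p k, |a p k| = 1 := fun p k => by rcases ha p k with h | h <;> simp [h]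
  have hdot : ∀ p, (∑ k, a p k * (a i k / K)) ^ 2 ≤ (m + 1) ^ 2 / K ^ 2 := by
    intro p
    rw [← div_pow]
    refine sq_le_sq' ?_ ?_
    all_goals
      have h : |∑ k, a p k * (a i k / K)| ≤ (m + 1) / K := by
        refine (Finset.abs_sum_le_sum_abs _ _).trans_eq ?_
        simp only [abs_mul, abs_div, habs, abs_of_pos hK]
        simp [div_eq_mul_inv]
      have := abs_le.1 h
      linarith
  have hself : (∑ k, a i k * (a i k / K)) = (m + 1) / K := by
    have : ∀ k, a i k * (a i k / K) = 1 / K := fun k => by rw [← mul_div_assoc, ← sq, hsq]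
    rw [Finset.sum_congr rfl fun k _ => this k]
    simp [div_eq_mul_inv]
  have hpt : ∀ p, ((∑ k, a p k * (a i k / K)) - if i = p then 1 else 0) ^ 2 ≤
      (m + 1) ^ 2 / K ^ 2 + if i = p then 1 - 2 * ((m + 1) / K) else 0 := by
    intro p
    have h := hdot p
    split_ifs with hp
    · subst hp
      rw [hself] at h ⊢
      linarith
    · simpa using h
  have hreg : K * ∑ k, (a i k / K) ^ 2 = (m + 1) / K := by
    simp only [div_pow, hsq, Finset.sum_const, Finset.card_univ, Fintype.card_fin, nsmul_eq_mul]
    push_cast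
    field_simp
  simp only [ridgeCost, Fin.snoc_castSucc, Fin.snoc_last]
  rw [hreg]
  have hsum := Finset.sum_le_sum fun p (_ : p ∈ Finset.univ) => hpt p
  rw [Finset.sum_add_distrib] at hsum
  simp only [Finset.sum_const, Finset.card_univ, Fintype.card_fin, nsmul_eq_mul,
    Finset.sum_ite_eq, Finset.mem_univ, if_true] at hsum
  rw [← mul_div_assoc] at hsum
  linarith

/-- Only row i of the data and the penalty are kept, and (S - 1)² ≥ 1 - 2S makes the bound
separable. Completing the square, each coordinate gains at most 1/K, and coordinate j gains nothing
if its sign is wrong. -/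
theorem le_ridgeCost (a : Fin n → Fin (m + 1) → ℝ) (ha : ∀ p k, a p k = 1 ∨ a p k = -1)
    (i : Fin n) (j : Fin (m + 1)) {K L : ℝ} (hK : 0 < K) (hL : 0 ≤ L) (v : Fin (m + 2) → ℝ)
    (hv : a i j * v j.castSucc ≤ 0) : 1 - m / K ≤ ridgeCost a i K L v := by
  have h1 : ((∑ k, a i k * v k.castSucc) - 1) ^ 2 ≤
      ∑ p, ((∑ k, a p k * v k.castSucc) - if i = p then 1 else 0) ^ 2 := by
    refine le_trans (le_of_eq ?_) (Finset.single_le_sum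
      (f := fun p => ((∑ k, a p k * v k.castSucc) - if i = p then 1 else 0) ^ 2)
      (fun p _ => sq_nonneg _) (Finset.mem_univ i))
    simp
  have h2 : -(m / K) ≤ ∑ k, (K * v k.castSucc ^ 2 - 2 * (a i k * v k.castSucc)) := by
    rw [← Finset.add_sum_erase _ _ (Finset.mem_univ j)]
    have h3 : ∑ _k ∈ Finset.univ.erase j, -(1 / K) ≤
        ∑ k ∈ Finset.univ.erase j, (K * v k.castSucc ^ 2 - 2 * (a i k * v k.castSucc)) := by
      refine Finset.sum_le_sum fun k _ => ?_
      have e : K * v k.castSucc ^ 2 - 2 * (a i k * v k.castSucc) + 1 / K =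
          (K * v k.castSucc - a i k) ^ 2 / K := by
        have hsq : a i k ^ 2 = 1 := by rcases ha i k with h | h <;> simp [h]
        field_simp
        linear_combination -hsq
      have : 0 ≤ (K * v k.castSucc - a i k) ^ 2 / K := by positivity
      linarith
    have h4 : ∑ _k ∈ Finset.univ.erase j, -(1 / K) = -(m / K) := by
      rw [Finset.sum_const, Finset.card_erase_of_mem (Finset.mem_univ j)]
      simp [div_eq_mul_inv]
    have h5 : 0 ≤ K * v j.castSucc ^ 2 := by positivity
    linarith
  rw [Finset.sum_sub_distrib, ← Finset.mul_sum, ← Finset.mul_sum] at h2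
  have h6 : 0 ≤ L * v (Fin.last (m + 1)) ^ 2 := by positivity
  unfold ridgeCost
  nlinarith [sq_nonneg (∑ k, a i k * v k.castSucc)]

/-- The regularization parameter for matrices with `n` rows and `m + 1` columns. -/
def ridgeParam (n m : ℕ) : ℕ := n * (m + 1) ^ 2 + 1

/-- The two bounds differ by 1/K - n(m+1)²/K², which the choice of `ridgeParam` makes exactly 1/K².
The resulting ε does not depend on L, so the bit stays readable however many rows are added to the
last column. -/
theorem mul_pos_of_ridgeCost_le (a : Fin n → Fin (m + 1) → ℝ)
    (ha : ∀ p k, a p k = 1 ∨ a p k = -1) (i : Fin n) (j : Fin (m + 1)) :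
    ∃ ε > (0 : ℝ), ∀ L : ℝ, 0 ≤ L → ∀ v : Fin (m + 2) → ℝ,
      (∀ u, √(ridgeCost a i (ridgeParam n m) L v) ≤
        (1 + ε) * √(ridgeCost a i (ridgeParam n m) L u)) →
      0 < a i j * v j.castSucc := by
  set K : ℝ := (ridgeParam n m : ℝ) with hK
  have hKe : K = n * (m + 1) ^ 2 + 1 := by simp [hK, ridgeParam]
  have hK1 : 1 ≤ K := by rw [hKe]; linarith [show (0 : ℝ) ≤ n * (m + 1) ^ 2 by positivity]
  have hK0 : 0 < K := by linarith
  have hγ0 : 0 < 1 / K ^ 2 := by positivity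
  have hγ1 : 1 / K ^ 2 ≤ 1 := by
    rw [div_le_one (by positivity)]
    nlinarith
  refine ⟨1 / K ^ 2 / 4, by positivity, fun L hL v hv => ?_⟩
  by_contra! hwrong
  have hlow := le_ridgeCost a ha i j hK0 hL v hwrong
  have hup := ridgeCost_candidate_le a ha i hK0 L
  have hu := pow_le_pow_left₀ (Real.sqrt_nonneg _)
    (hv (Fin.snoc (α := fun _ => ℝ) (fun k => a i k / K) 0)) 2
  have hc0 := ridgeCost_nonneg a i hK0.le hL (Fin.snoc (α := fun _ => ℝ) (fun k => a i k / K) 0)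
  rw [mul_pow, Real.sq_sqrt (ridgeCost_nonneg a i hK0.le hL v), Real.sq_sqrt hc0] at hu
  set f := ridgeCost a i K L (Fin.snoc (α := fun _ => ℝ) (fun k => a i k / K) 0)
  have hgap : 1 - (m + 1) / K + n * (m + 1) ^ 2 / K ^ 2 = 1 - m / K - 1 / K ^ 2 := by
    have : (n : ℝ) * (m + 1) ^ 2 = K - 1 := by linarith
    rw [this]
    field_simp
    ring
  have hm0 : 0 ≤ m / K := by positivity
  set γ := 1 / K ^ 2
  have hf1 : f ≤ 1 := by linarith
  have h3 : (1 + γ / 4) ^ 2 * f ≤ f + 3 * (γ / 4) := by nlinarith [mul_nonneg hγ0.le hc0]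
  linarith

/-- The column in which the `u`-th new row has its entry. -/
def newRowCol (n m u : ℕ) : Fin (m + 2) :=
  if u < ridgeParam n m * (m + 1) then (Fin.ofNat (m + 1) u).castSucc else Fin.last (m + 1)

/-- The `i`-th unit target, then regularizing rows, then rows which only concern the last column. -/
def ridgeSuffix (n m i : ℕ) : RegStream ℕ (m + 2)
  | 0 => (.target i, 1)
  | u + 1 => (.entry (n + u) (newRowCol n m u), 1)

/-- All entries of the first `n` rows in all columns but the last one are signs encoding bits; then
follows a query of one of them. -/
noncomputable def uniqueStream (x : Fin n × Fin (m + 1) → Bool) (q : Fin n × Fin (m + 1)) :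
    RegStream ℕ (m + 2) :=
  RegStream.append (encodeBits (fun q => .entry (q.1 : ℕ) q.2.castSucc) x) (ridgeSuffix n m q.1)

theorem uniqueStream_of_lt (x : Fin n × Fin (m + 1) → Bool) (q : Fin n × Fin (m + 1)) {s : ℕ}
    (hs : s < n * (m + 1)) : uniqueStream x q s =
      (.entry ((finProdFinEquiv.symm ⟨s, hs⟩).1 : ℕ) (finProdFinEquiv.symm ⟨s, hs⟩).2.castSucc,
        bitSign (x (finProdFinEquiv.symm ⟨s, hs⟩))) :=
  RegStream.append_of_lt _ _ hs

theorem uniqueStream_add (x : Fin n × Fin (m + 1) → Bool) (q : Fin n × Fin (m + 1)) (s : ℕ) :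
    uniqueStream x q (n * (m + 1) + s) = ridgeSuffix n m q.1 s :=
  RegStream.append_add _ _ s

/-- Each new update opens a fresh row n + u, so no coordinate recurs although the stream is
infinite. -/
theorem uniqueStream_mem {D : Set ℝ} (h1 : 1 ∈ D) (h2 : -1 ∈ D)
    (x : Fin n × Fin (m + 1) → Bool) (q : Fin n × Fin (m + 1)) :
    uniqueStream x q ∈ RegStream.uniqueTurnstile ℕ (m + 2) D := by
  constructor
  · intro t
    rcases lt_or_ge t (n * (m + 1)) with ht | ht
    · rw [uniqueStream_of_lt x q ht]
      exact bitSign_mem h1 h2 _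
    · obtain ⟨s, rfl⟩ := Nat.exists_eq_add_of_le ht
      rw [uniqueStream_add]
      cases s <;> exact h1
  · have hne : ∀ s (hs : s < n * (m + 1)) t,
        (uniqueStream x q s).1 ≠ (ridgeSuffix n m q.1 t).1 := by
      intro s hs t
      rw [uniqueStream_of_lt x q hs]
      cases t with
      | zero => simp [ridgeSuffix]
      | succ t =>
        intro h
        simp only [ridgeSuffix, RegCoord.entry.injEq] at h
        have := (finProdFinEquiv.symm ⟨s, hs⟩).1.2
        omega
    intro s t hst
    dsimp only at hst
    rcases lt_or_ge s (n * (m + 1)) with hs | hs <;> rcases lt_or_ge t (n * (m + 1)) with ht | ht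
    · rw [uniqueStream_of_lt x q hs, uniqueStream_of_lt x q ht] at hst
      simp only [RegCoord.entry.injEq] at hst
      have := finProdFinEquiv.symm.injective
        (Prod.ext (Fin.ext hst.1) (Fin.castSucc_injective _ hst.2))
      simpa using this
    · obtain ⟨t, rfl⟩ := Nat.exists_eq_add_of_le ht
      rw [uniqueStream_add] at hst
      exact absurd hst (hne s hs t)
    · obtain ⟨s, rfl⟩ := Nat.exists_eq_add_of_le hs
      rw [uniqueStream_add] at hst
      exact absurd hst.symm (hne t ht s)
    · obtain ⟨s, rfl⟩ := Nat.exists_eq_add_of_le hs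
      obtain ⟨t, rfl⟩ := Nat.exists_eq_add_of_le ht
      rw [uniqueStream_add, uniqueStream_add] at hst
      cases s <;> cases t <;> simp [ridgeSuffix] at hst ⊢
      exact hst.1

open Classical in
theorem uniqueStream_value (x : Fin n × Fin (m + 1) → Bool) (q : Fin n × Fin (m + 1)) (s : ℕ)
    (c : RegCoord ℕ (m + 2)) :
    (uniqueStream x q).value (n * (m + 1) + (1 + s)) c =
      (∑ q : Fin n × Fin (m + 1),
        if RegCoord.entry (q.1 : ℕ) q.2.castSucc = c then bitSign (x q) else 0) +
      ((if RegCoord.target (q.1 : ℕ) = c then 1 else 0) +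
        ∑ u ∈ Finset.range s, if RegCoord.entry (n + u) (newRowCol n m u) = c then 1 else 0) := by
  rw [uniqueStream, RegStream.value_append, sum_encodeBits, RegStream.value_add]
  congr 1
  congr 1
  · rw [RegStream.value, Finset.sum_range_one]
    rfl
  · simp only [RegStream.value, add_comm 1, ridgeSuffix]

theorem uniqueStream_mulVec_of_lt (x : Fin n × Fin (m + 1) → Bool) (q : Fin n × Fin (m + 1))
    (s : ℕ) (v : Fin (m + 2) → ℝ) (p : Fin n) :
    ((uniqueStream x q).mat (n * (m + 1) + (1 + s))).mulVec v p =
      ∑ k, bitSign (x (p, k)) * v k.castSucc := by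
  classical
  have hzero : ∀ k : Fin (m + 2), (∑ u ∈ Finset.range s,
      if RegCoord.entry (n + u) (newRowCol n m u) = RegCoord.entry (p : ℕ) k then (1 : ℝ) else 0)
      = 0 := by
    intro k
    refine Finset.sum_eq_zero fun u _ => if_neg fun h => ?_
    have := p.2
    simp only [RegCoord.entry.injEq] at h
    omega
  simp only [Matrix.mulVec, dotProduct, RegStream.mat, uniqueStream_value, hzero, reduceCtorEq,
    if_false, add_zero]
  rw [Fin.sum_univ_castSucc]
  have hlast : (∑ q : Fin n × Fin (m + 1),
      if RegCoord.entry (q.1 : ℕ) q.2.castSucc = RegCoord.entry (p : ℕ) (Fin.last (m + 1))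
        then bitSign (x q) else 0) = 0 :=
    Finset.sum_eq_zero fun q _ => if_neg fun h => by
      simp only [RegCoord.entry.injEq] at h
      exact (Fin.castSucc_lt_last q.2).ne h.2
  rw [hlast, zero_mul, add_zero]
  refine Finset.sum_congr rfl fun k _ => ?_
  rw [Finset.sum_eq_single (p, k)]
  · simp
  · rintro ⟨p', k'⟩ _ hne
    refine if_neg fun e => hne ?_
    simp only [RegCoord.entry.injEq] at e
    exact Prod.ext (Fin.ext e.1) (Fin.castSucc_injective _ e.2)
  · simp

theorem uniqueStream_mulVec_add (x : Fin n × Fin (m + 1) → Bool) (q : Fin n × Fin (m + 1))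
    (s : ℕ) (v : Fin (m + 2) → ℝ) (u : ℕ) :
    ((uniqueStream x q).mat (n * (m + 1) + (1 + s))).mulVec v (n + u) =
      if u < s then v (newRowCol n m u) else 0 := by
  classical
  have hzero : ∀ k : Fin (m + 2), (∑ q : Fin n × Fin (m + 1),
      if RegCoord.entry (q.1 : ℕ) q.2.castSucc = RegCoord.entry (n + u) k
        then bitSign (x q) else 0) = 0 := by
    intro k
    refine Finset.sum_eq_zero fun q _ => if_neg fun h => ?_
    have := q.1.2
    simp only [RegCoord.entry.injEq] at h
    omega
  have hsum : ∀ k : Fin (m + 2), (∑ u' ∈ Finset.range s,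
      if RegCoord.entry (n + u') (newRowCol n m u') = RegCoord.entry (n + u) k
        then (1 : ℝ) else 0) = if u < s ∧ newRowCol n m u = k then 1 else 0 := by
    intro k
    have : ∀ u', (if RegCoord.entry (n + u') (newRowCol n m u') = RegCoord.entry (n + u) k
        then (1 : ℝ) else 0) = if u = u' then (if newRowCol n m u = k then 1 else 0) else 0 := by
      intro u'
      by_cases h : u = u'
      · subst h; simp
      · simp [h, Ne.symm h]
    simp only [this, Finset.sum_ite_eq, Finset.mem_range, ite_and]
  simp only [Matrix.mulVec, dotProduct, RegStream.mat, uniqueStream_value, hzero, hsum,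
    reduceCtorEq, if_false, zero_add]
  by_cases h : u < s <;> simp [h]

theorem uniqueStream_rhs (x : Fin n × Fin (m + 1) → Bool) (q : Fin n × Fin (m + 1)) (s p : ℕ) :
    (uniqueStream x q).rhs (n * (m + 1) + (1 + s)) p = if (q.1 : ℕ) = p then 1 else 0 := by
  classical
  rw [RegStream.rhs, uniqueStream_value]
  simp

theorem sum_newRowCol (n m s : ℕ) (g : Fin (m + 2) → ℝ) :
    ∑ u ∈ Finset.range (ridgeParam n m * (m + 1) + s), g (newRowCol n m u) =
      ridgeParam n m * ∑ k : Fin (m + 1), g k.castSucc + s * g (Fin.last (m + 1)) := by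
  rw [Finset.sum_range_add]
  congr 1
  · have h : ∀ K : ℕ, ∑ u ∈ Finset.range (K * (m + 1)), g (Fin.ofNat (m + 1) u).castSucc =
        K * ∑ k : Fin (m + 1), g k.castSucc := by
      intro K
      induction K with
      | zero => simp
      | succ K ih =>
        rw [Nat.succ_mul, Finset.sum_range_add, ih, Nat.cast_succ, add_one_mul]
        congr 1
        rw [Finset.sum_range]
        refine Finset.sum_congr rfl fun k _ => congrArg g (congrArg Fin.castSucc (Fin.ext ?_))
        simp [Fin.ofNat, Nat.mod_eq_of_lt k.2]
    rw [← h]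
    refine Finset.sum_congr rfl fun u hu => ?_
    rw [newRowCol, if_pos (Finset.mem_range.1 hu)]
  · simp [newRowCol]

theorem uniqueStream_cost (x : Fin n × Fin (m + 1) → Bool) (q : Fin n × Fin (m + 1)) (s : ℕ)
    (v : Fin (m + 2) → ℝ) :
    lsCost ((uniqueStream x q).mat (n * (m + 1) + (1 + (ridgeParam n m * (m + 1) + s))))
        ((uniqueStream x q).rhs (n * (m + 1) + (1 + (ridgeParam n m * (m + 1) + s)))) v =
      √(ridgeCost (fun p k => bitSign (x (p, k))) q.1 (ridgeParam n m) s v) := by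
  set t := ridgeParam n m * (m + 1) + s with ht
  rw [lsCost]
  congr 1
  have hge : ∀ u, ((uniqueStream x q).mat (n * (m + 1) + (1 + t))).mulVec v (n + u) -
      (uniqueStream x q).rhs (n * (m + 1) + (1 + t)) (n + u) =
      if u < t then v (newRowCol n m u) else 0 := by
    intro u
    have hne : (q.1 : ℕ) ≠ n + u := by omega
    rw [uniqueStream_mulVec_add, uniqueStream_rhs, if_neg hne, sub_zero]
  rw [finsum_eq_sum_of_support_subset (s := Finset.range (n + t))]
  · rw [Finset.sum_range_add, Finset.sum_range, ridgeCost]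
    congr 1
    · refine Finset.sum_congr rfl fun p _ => ?_
      rw [uniqueStream_mulVec_of_lt, uniqueStream_rhs]
      simp only [Fin.ext_iff]
    · rw [← sum_newRowCol n m s fun k => v k ^ 2]
      refine Finset.sum_congr rfl fun u hu => ?_
      rw [hge, if_pos (Finset.mem_range.1 hu)]
  · intro p hp
    rw [Finset.coe_range, Set.mem_Iio]
    by_contra! hlt
    obtain ⟨u, rfl⟩ := Nat.exists_eq_add_of_le ((Nat.le_add_right n t).trans hlt)
    refine hp ?_
    dsimp only
    rw [hge, if_neg (by omega)]
    norm_num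

theorem uniqueStream_decode (x : Fin n × Fin (m + 1) → Bool) (q : Fin n × Fin (m + 1)) :
    ∃ ε > (0 : ℝ), ∀ s : ℕ, ∀ v : Fin (m + 2) → ℝ,
      (∀ u : Fin (m + 2) → ℝ,
        lsCost ((uniqueStream x q).mat (n * (m + 1) + (1 + (ridgeParam n m * (m + 1) + s))))
          ((uniqueStream x q).rhs (n * (m + 1) + (1 + (ridgeParam n m * (m + 1) + s)))) v ≤
        (1 + ε) *
        lsCost ((uniqueStream x q).mat (n * (m + 1) + (1 + (ridgeParam n m * (m + 1) + s))))
          ((uniqueStream x q).rhs (n * (m + 1) + (1 + (ridgeParam n m * (m + 1) + s)))) u) →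
      decide (0 < v q.2.castSucc) = x q := by
  obtain ⟨ε, hε, H⟩ := mul_pos_of_ridgeCost_le (fun p k => bitSign (x (p, k)))
    (fun p k => bitSign_eq_or _) q.1 q.2
  refine ⟨ε, hε, fun s v hv => ?_⟩
  simp only [uniqueStream_cost] at hv
  have hpos := H s (Nat.cast_nonneg s) v hv
  cases hb : x q
  · have hb' : bitSign (x (q.1, q.2)) = -1 := by rw [Prod.mk.eta, hb]; rfl
    rw [hb'] at hpos
    simp only [decide_eq_false_iff_not, not_lt]
    linarith
  · have hb' : bitSign (x (q.1, q.2)) = 1 := by rw [Prod.mk.eta, hb]; rfl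
    rw [hb', one_mul] at hpos
    simpa using hpos

end Unique

/-! ### Assembling the three bounds -/

theorem rpow_le_pow_of_le_mul_logb {κ c : ℝ} (hκ : 1 < κ) {N : ℕ}
    (h : c ≤ N * Real.logb 4 κ) : (4 : ℝ) ^ c ≤ κ ^ N := by
  calc (4 : ℝ) ^ c ≤ (4 : ℝ) ^ (Real.logb 4 κ * N) :=
        Real.rpow_le_rpow_of_exponent_le (by norm_num) (by linarith)
    _ = κ ^ N := by
        rw [Real.rpow_mul (by norm_num), Real.rpow_logb (by norm_num) (by norm_num) (by linarith),
          Real.rpow_natCast]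

theorem mainTheorem11 (δ : ℝ) (hδ₀ : 0 < δ) (hδ : δ < 1 / 2) :
    ∃ c : ℝ, 0 < c ∧
      ∀ (D : Set ℝ), 1 ∈ D → -1 ∈ D →
      ∀ (Ω : Type*) [MeasurableSpace Ω] (μ : Measure Ω) [IsProbabilityMeasure μ],
        -- turnstile updates
        (∀ n d : ℕ, 1 ≤ d → d ≤ n → ∀ alg : RegAlgorithm Ω (Fin n) d,
          alg.AsymptoticallyExactOn μ δ (RegStream.turnstile (Fin n) d D) →
          ∃ S ∈ RegStream.turnstile (Fin n) d D, ∃ t ≤ n * d,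
            alg.UsesBits μ S t (c * n * d)) ∧
        -- unique turnstile updates; the number of rows is unbounded, and only the first `n` rows
        -- have been touched when the memory is measured
        (∀ d : ℕ, 2 ≤ d → ∀ alg : RegAlgorithm Ω ℕ d,
          alg.AsymptoticallyExactOn μ δ (RegStream.uniqueTurnstile ℕ d D) →
          ∀ n : ℕ, ∃ S ∈ RegStream.uniqueTurnstile ℕ d D, ∃ t ≤ n * d,
            (∀ s < t, (S s).1.row < n) ∧ alg.UsesBits μ S t (c * n * d)) ∧
        -- turnstile updates with diverging smallest singular value
        (∀ n d : ℕ, 1 ≤ d → d ≤ n → ∀ alg : RegAlgorithm Ω (Fin n) d,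
          alg.AsymptoticallyExactOn μ δ (RegStream.divergingTurnstile n d D) →
          ∃ S ∈ RegStream.divergingTurnstile n d D, ∃ t ≤ n * d,
            alg.UsesBits μ S t (c * n * d)) := by
  obtain ⟨κ, hκ, H⟩ := RegAlgorithm.exists_usesBits_of_decode hδ₀ hδ
  have hlog : 0 < Real.logb 4 κ := Real.logb_pos (by norm_num) hκ
  refine ⟨Real.logb 4 κ / 2, by positivity, fun D h1 h2 Ω _ μ _ => ?_⟩
  have hdiv : ∀ n d : ℕ, 1 ≤ d → d ≤ n → ∀ alg : RegAlgorithm Ω (Fin n) d,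
      alg.AsymptoticallyExactOn μ δ (RegStream.divergingTurnstile n d D) →
      ∃ S ∈ RegStream.divergingTurnstile n d D, ∃ t ≤ n * d,
        alg.UsesBits μ S t (Real.logb 4 κ / 2 * n * d) := by
    intro n d hd hdn alg halg
    have : Nonempty (Fin n × Fin d) := ⟨(⟨0, by omega⟩, ⟨0, hd⟩)⟩
    obtain ⟨x, q, h⟩ := H μ alg _ halg (divergingStream hdn) (n * d)
      (fun K => n * d + K * (d + 1)) (fun q v => decide (v q.2 < 1))
      (Real.logb 4 κ / 2 * n * d) (fun x q => divergingStream_mem hdn hd h1 h2 x q)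
      (fun x q q' s hs => by
        rw [divergingStream, divergingStream, RegStream.append_of_lt _ _ hs,
          RegStream.append_of_lt _ _ hs])
      (fun x x' q s hs => by
        obtain ⟨s, rfl⟩ := Nat.exists_eq_add_of_le hs
        rw [divergingStream, divergingStream, RegStream.append_add, RegStream.append_add])
      (tendsto_atTop_mono (fun K => (Nat.le_mul_of_pos_right K d.succ_pos).trans
        (Nat.le_add_left _ _)) tendsto_id)
      (divergingStream_decode hdn hd)
      (rpow_le_pow_of_le_mul_logb hκ (by
        simp only [Fintype.card_prod, Fintype.card_fin, Nat.cast_mul]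
        nlinarith [show (0 : ℝ) ≤ n * d * Real.logb 4 κ by positivity]))
    exact ⟨_, divergingStream_mem hdn hd h1 h2 x q, n * d, le_rfl, h⟩
  refine ⟨fun n d hd hdn alg halg => ?_, fun d hd alg halg n => ?_, hdiv⟩
  -- The diverging streams form a subclass: exactness restricts to it, and the hard stream found
  -- there is a turnstile stream.
  · obtain ⟨S, hS, h⟩ := hdiv n d hd hdn alg fun S hS => halg S hS.1
    exact ⟨S, hS.1, h⟩
  · obtain ⟨m, rfl⟩ := Nat.exists_eq_add_of_le' hd
    rcases Nat.eq_zero_or_pos n with rfl | hn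
    -- For n = 0 the bound is zero bits, so any unique stream works at time 0.
    · refine ⟨fun s => (.entry s 0, 1), ⟨fun _ => h1, fun s t hst => ?_⟩, 0, Nat.zero_le _, by simp, ?_⟩
      · simpa using hst
      · simp [RegAlgorithm.UsesBits]
    · have : Nonempty (Fin n × Fin (m + 1)) := ⟨(⟨0, hn⟩, 0)⟩
      obtain ⟨x, q, h⟩ := H μ alg _ halg uniqueStream (n * (m + 1))
        (fun s => n * (m + 1) + (1 + (ridgeParam n m * (m + 1) + s)))
        (fun q v => decide (0 < v q.2.castSucc))
        (Real.logb 4 κ / 2 * n * (m + 2 : ℕ)) (fun x q => uniqueStream_mem h1 h2 x q)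
        (fun x q q' s hs => by rw [uniqueStream_of_lt _ _ hs, uniqueStream_of_lt _ _ hs])
        (fun x x' q s hs => by
          obtain ⟨s, rfl⟩ := Nat.exists_eq_add_of_le hs
          rw [uniqueStream_add, uniqueStream_add])
        (tendsto_atTop_mono (fun s => by dsimp only [id]; omega) tendsto_id)
        (fun x q => by
          obtain ⟨ε, hε, hdec⟩ := uniqueStream_decode x q
          exact ⟨ε, hε, Eventually.of_forall hdec⟩)
        -- Only m + 1 of the m + 2 columns carry bits; m + 1 ≥ (m + 2)/2 is what the factor 1/2 in
        -- the constant pays for.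
        (rpow_le_pow_of_le_mul_logb hκ (by
          simp only [Fintype.card_prod, Fintype.card_fin, Nat.cast_mul]
          push_cast
          nlinarith [show (0 : ℝ) ≤ n * m * Real.logb 4 κ by positivity]))
      refine ⟨_, uniqueStream_mem h1 h2 x q, n * (m + 1), by gcongr; omega, fun s hs => ?_, h⟩
      rw [uniqueStream_of_lt x q hs]
      exact Fin.is_lt _
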